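/- Let $d>2$ be an integer and let $k$ be an algebraically closed field whose characteristic is $0$ or greater than $d$. Let $f,g\in k[x_1,\dots,x_n]$ be two homogeneous polynomials of degree $d$ with the same Jacobian ideal, i.e. $$\left(\frac{\partial f}{\partial x_1},\dots,\frac{\partial f}{\partial x_n}\right)=\left(\frac{\partial g}{\partial x_1},\dots,\frac{\partial g}{\partial x_n}\right)$$ as ideals of $k[x_1,\dots,x_n]$. Then there is an invertible matrix $P\in GL_n(k)$ such that $g(x)=f(Px)$, that is, $g$ is obtained from $f$ by substituting $\sum_{j} P_{ij}x_j$ for each variable $x_i$. -/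

import Mathlib

/-- The Jacobian ideal `J(f)` of a polynomial `f` in `n` variables: the ideal generated by the
partial derivatives of `f`. -/
noncomputable def jacobianIdeal {k : Type*} [Field k] {n : ℕ} (f : MvPolynomial (Fin n) k) :
    Ideal (MvPolynomial (Fin n) k) :=
  Ideal.span (Set.range fun i : Fin n => MvPolynomial.pderiv i f)

/-- The composition `f ∘ P` of a polynomial `f` in `n` variables with the linear map given by the
matrix `P`: the variable `x i` is replaced by the linear form `∑ j, P i j * x j`. -/
noncomputable def compLinear {k : Type*} [Field k] {n : ℕ} (f : MvPolynomial (Fin n) k)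
    (P : Matrix (Fin n) (Fin n) k) : MvPolynomial (Fin n) k :=
  MvPolynomial.bind₁
    (fun i : Fin n => ∑ j : Fin n, MvPolynomial.C (P i j) * MvPolynomial.X j) f

/-- As a function on `k ^ n`, `compLinear f P` is `x ↦ f (P x)`. -/
theorem eval_compLinear {k : Type*} [Field k] {n : ℕ} (f : MvPolynomial (Fin n) k)
    (P : Matrix (Fin n) (Fin n) k) (x : Fin n → k) :
    MvPolynomial.eval x (compLinear f P) = MvPolynomial.eval (P.mulVec x) f := by
  have h : P.mulVec x = fun i => MvPolynomial.eval x
      (∑ j : Fin n, MvPolynomial.C (P i j) * MvPolynomial.X j) := by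
    funext i
    simp [Matrix.mulVec, dotProduct]
  rw [h, compLinear, MvPolynomial.eval, MvPolynomial.eval₂Hom_bind₁]
  rfl

/-!
The idea is to pass to polarizations. Let `F` and `G` be the symmetric `d`-linear forms with
`f x = F (x, …, x)` and `g x = G (x, …, x)`. In degree `d - 1` the Jacobian ideal is the linear span
of the partial derivatives, so equality of the ideals gives an invertible constant matrix `B` with
`∇g = Bᵀ ∇f` (`span_pderiv_eq_of_jacobianIdeal_eq`, `exists_isUnit_matrix_of_span_range_eq`), that
is, `G (x, y, …) = F (B x, y, …)`. As `G` is symmetric, `B` is self-adjoint with respect to `F`: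
it can be moved freely between the arguments of `F` (`hessianSelfAdjoint_of_pderiv_eq`).

Over an algebraically closed field in which `d ≠ 0`, the invertible matrix `B` has a `d`-th root `P`
that is a polynomial in `B` (`Matrix.exists_aeval_pow_eq`), so `P` is self-adjoint as well
(`HessianSelfAdjoint.aeval`). Therefore
`f (P x) = F (P x, …, P x) = F (P ^ d x, x, …, x) = F (B x, x, …, x) = g x`.

Multilinear forms do not appear in the formal argument: self-adjointness is expressed by the
Hessian matrix, and the middle equality is `HessianSelfAdjoint.natCast_mul_compLinear`, proved by
induction on the degree with Euler's identity.
-/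

/-! ### Hessians and self-adjoint matrices -/

open MvPolynomial in
theorem pderiv_pderiv_comm {R σ : Type*} [CommRing R] (i j : σ) (p : MvPolynomial σ R) :
    pderiv i (pderiv j p) = pderiv j (pderiv i p) := by
  classical
  let D (l : σ) : Derivation R (MvPolynomial σ R) (MvPolynomial σ R) := pderiv l
  have h : ⁅D i, D j⁆ = 0 := by
    refine MvPolynomial.derivation_ext fun l => ?_
    simp only [D, Derivation.commutator_apply, pderiv_X, Derivation.coe_zero, Pi.zero_apply]
    simp only [Pi.single_apply]
    split_ifs <;> simp
  have := congrArg (fun E => E p) h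
  simpa [D, Derivation.commutator_apply, sub_eq_zero] using this

section Hessian

open MvPolynomial Matrix

variable {k : Type*} [Field k] {n : ℕ}

/-- The gradient of a polynomial, as a vector of polynomials. -/
noncomputable def polyGradient (f : MvPolynomial (Fin n) k) : Fin n → MvPolynomial (Fin n) k :=
  fun i => pderiv i f

/-- The Hessian matrix of second partial derivatives of a polynomial. -/
noncomputable def polyHessian (f : MvPolynomial (Fin n) k) :
    Matrix (Fin n) (Fin n) (MvPolynomial (Fin n) k) :=
  Matrix.of fun i j => pderiv i (pderiv j f)

/-- A constant matrix `P` is self-adjoint for the Hessian of `f`: the matrix `Hess f * P` is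
symmetric. Equivalently, `P` is self-adjoint for the symmetric multilinear form polarizing `f`. -/
def HessianSelfAdjoint (f : MvPolynomial (Fin n) k) (P : Matrix (Fin n) (Fin n) k) : Prop :=
  polyHessian f * P.map C = (P.map C)ᵀ * polyHessian f

theorem polyHessian_pderiv (f : MvPolynomial (Fin n) k) (l : Fin n) :
    polyHessian (pderiv l f) = (polyHessian f).map (pderiv l) := by
  ext1 i j
  simp only [polyHessian, Matrix.of_apply, Matrix.map_apply]
  rw [pderiv_pderiv_comm j l, pderiv_pderiv_comm i l]

theorem HessianSelfAdjoint.pderiv {f : MvPolynomial (Fin n) k} {P : Matrix (Fin n) (Fin n) k}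
    (h : HessianSelfAdjoint f P) (l : Fin n) : HessianSelfAdjoint (pderiv l f) P := by
  unfold HessianSelfAdjoint at h ⊢
  ext1 i j
  have hij := congrArg (MvPolynomial.pderiv l) (congrFun (congrFun h i) j)
  simpa [polyHessian_pderiv, Matrix.mul_apply, Derivation.leibniz, mul_comm] using hij

/-- Powers of a self-adjoint matrix are self-adjoint, hence so are polynomials in it. -/
theorem HessianSelfAdjoint.aeval {f : MvPolynomial (Fin n) k} {B : Matrix (Fin n) (Fin n) k}
    (h : HessianSelfAdjoint f B) (p : Polynomial k) :
    HessianSelfAdjoint f (Polynomial.aeval B p) := by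
  have hpow (m : ℕ) : HessianSelfAdjoint f (B ^ m) := by
    have hs : SemiconjBy (polyHessian f) (B.map C) (B.map C)ᵀ := h
    have := hs.pow_right m
    rw [← Matrix.transpose_pow] at this
    have e : (B ^ m).map C = (B.map (C : k →+* MvPolynomial (Fin n) k)) ^ m :=
      map_pow (C : k →+* MvPolynomial (Fin n) k).mapMatrix B m
    unfold HessianSelfAdjoint
    rw [e]
    exact this
  induction p using Polynomial.induction_on' with
  | add p q hp hq =>
    unfold HessianSelfAdjoint at *
    rw [map_add, Matrix.map_add _ (map_add _), Matrix.transpose_add, mul_add, add_mul, hp, hq]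
  | monomial m a =>
    have hm := hpow m
    unfold HessianSelfAdjoint at *
    have e : (a • B ^ m).map C =
        (C a : MvPolynomial (Fin n) k) • (B ^ m).map (C : k →+* MvPolynomial (Fin n) k) := by
      ext1 i j
      simp
    rw [Polynomial.aeval_monomial, ← Algebra.smul_def, e, Matrix.transpose_smul,
      Matrix.mul_smul, Matrix.smul_mul, hm]

theorem X_dotProduct_polyGradient {f : MvPolynomial (Fin n) k} {d : ℕ} (hf : f.IsHomogeneous d) :
    (X : Fin n → MvPolynomial (Fin n) k) ⬝ᵥ polyGradient f = (d : MvPolynomial (Fin n) k) * f := by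
  simpa [dotProduct, polyGradient] using hf.sum_X_mul_pderiv

theorem polyHessian_mulVec_X {f : MvPolynomial (Fin n) k} {d : ℕ}
    (hf : f.IsHomogeneous (d + 1)) :
    polyHessian f *ᵥ X = (d : MvPolynomial (Fin n) k) • polyGradient f := by
  ext1 i
  have := X_dotProduct_polyGradient (hf.pderiv (i := i))
  simp only [Nat.add_sub_cancel] at this
  simp only [Pi.smul_apply, smul_eq_mul]
  unfold polyGradient at this ⊢
  rw [← this]
  simp only [Matrix.mulVec, dotProduct, polyHessian, Matrix.of_apply]
  exact Finset.sum_congr rfl fun j _ => by rw [mul_comm, pderiv_pderiv_comm]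

theorem compLinear_eq_bind₁ (f : MvPolynomial (Fin n) k) (P : Matrix (Fin n) (Fin n) k) :
    compLinear f P = bind₁ (P.map C *ᵥ X) f := rfl

/-- In terms of the symmetric multilinear form `F` with `f x = F (x, …, x)`, this is the identity
`F (P x, …, P x) = F (P ^ d x, x, …, x)`, which holds because self-adjointness allows `P` to be
moved from one argument to another. -/
theorem HessianSelfAdjoint.natCast_mul_compLinear {P : Matrix (Fin n) (Fin n) k} {d : ℕ}
    (hd : ∀ m : ℕ, 0 < m → m ≤ d → (m : k) ≠ 0) (hd0 : 0 < d) {f : MvPolynomial (Fin n) k}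
    (hf : f.IsHomogeneous d) (h : HessianSelfAdjoint f P) :
    (d : MvPolynomial (Fin n) k) * compLinear f P =
      ((P.map C) ^ d *ᵥ X) ⬝ᵥ polyGradient f := by
  induction d, hd0 using Nat.le_induction generalizing f with
  | base =>
    have := congrArg (bind₁ (P.map C *ᵥ X)) (X_dotProduct_polyGradient hf)
    have hc (i : Fin n) : bind₁ (P.map C *ᵥ X) (MvPolynomial.pderiv i f) =
        MvPolynomial.pderiv i f := by
      have h0 : (MvPolynomial.pderiv i f).IsHomogeneous 0 := hf.pderiv
      rw [(totalDegree_eq_zero_iff_eq_C).1 (Nat.le_zero.1 h0.totalDegree_le)]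
      simp
    simp only [dotProduct, map_sum, map_mul, bind₁_X_right, map_natCast] at this
    rw [compLinear_eq_bind₁, ← this]
    simp [dotProduct, polyGradient, hc]
  | succ d hd1 ih =>
    have hd' : (d : MvPolynomial (Fin n) k) ≠ 0 := by
      rw [← map_natCast (C : k →+* MvPolynomial (Fin n) k)]
      exact (map_ne_zero_iff _ (C_injective _ _)).2 (hd d hd1 (Nat.le_succ d))
    have euler := congrArg (bind₁ (P.map C *ᵥ X)) (X_dotProduct_polyGradient hf)
    simp only [dotProduct, map_sum, map_mul, bind₁_X_right, map_natCast] at euler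
    have hpart (i : Fin n) : (d : MvPolynomial (Fin n) k) *
        bind₁ (P.map C *ᵥ X) (polyGradient f i) =
        (((P.map C) ^ d *ᵥ X) ᵥ* polyHessian f) i :=
      ih (fun m h0 hm => hd m h0 (hm.trans (Nat.le_succ d))) hf.pderiv (h.pderiv i)
    apply mul_left_cancel₀ hd'
    calc (d : MvPolynomial (Fin n) k) * (((d + 1 : ℕ) : MvPolynomial (Fin n) k) * compLinear f P)
        = (((P.map C) ^ d *ᵥ X) ᵥ* polyHessian f) ⬝ᵥ (P.map C *ᵥ X) := by
          rw [compLinear_eq_bind₁, ← euler, Finset.mul_sum]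
          refine Finset.sum_congr rfl fun i _ => ?_
          rw [← hpart i]
          ring
      _ = ((P.map C) ^ (d + 1) *ᵥ X) ⬝ᵥ (polyHessian f *ᵥ X) := by
          -- Self-adjointness moves the last factor `P` across the Hessian.
          rw [← Matrix.dotProduct_mulVec, Matrix.mulVec_mulVec, h, ← Matrix.mulVec_mulVec,
            Matrix.dotProduct_mulVec _ (P.map C)ᵀ, Matrix.vecMul_transpose,
            Matrix.mulVec_mulVec, ← pow_succ']
      _ = (d : MvPolynomial (Fin n) k) * (((P.map C) ^ (d + 1) *ᵥ X) ⬝ᵥ polyGradient f) := by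
          rw [polyHessian_mulVec_X hf, dotProduct_smul, smul_eq_mul]

end Hessian

/-! ### Roots of invertible matrices -/

section RootExtraction

open Polynomial

/-- The class of `X` has a `d`-th root in `K[X] / (m)`. Modulo the nilradical the root is found by
Lagrange interpolation at the roots of `m`; it lifts along the nilpotent ideal by Newton's method,
where `d ≠ 0` in `K` and `m.coeff 0 ≠ 0` make the derivative `d * q ^ (d - 1)` a unit. -/
theorem exists_dvd_pow_sub_X {K : Type*} [Field K] [IsAlgClosed K] {d : ℕ} (hd : (d : K) ≠ 0)
    {m : K[X]} (hm0 : m.coeff 0 ≠ 0) : ∃ p : K[X], m ∣ p ^ d - X := by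
  classical
  have hd0 : d ≠ 0 := by
    rintro rfl
    simp at hd
  have hm : m ≠ 0 := by
    rintro rfl
    simp at hm0
  choose r hr using fun a : K => IsAlgClosed.exists_pow_nat_eq a (Nat.pos_of_ne_zero hd0)
  let q : K[X] := Lagrange.interpolate m.roots.toFinset id r
  have hq (a : K) (ha : a ∈ m.roots) : X - C a ∣ q ^ d - X := by
    have e : q.eval a = r a :=
      Lagrange.eval_interpolate_at_node r (Function.injective_id.injOn) (Multiset.mem_toFinset.2 ha)
    rw [dvd_iff_isRoot]
    simp [e, hr]
  have hnil : IsNilpotent (AdjoinRoot.mk m (q ^ d - X)) := by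
    refine ⟨Multiset.card m.roots, ?_⟩
    rw [← map_pow, AdjoinRoot.mk_eq_zero]
    have hdvd : (m.roots.map fun a => X - C a).prod ∣ (m.roots.map fun _ => q ^ d - X).prod :=
      Multiset.prod_dvd_prod_of_dvd _ _ hq
    rw [Multiset.map_const', Multiset.prod_replicate] at hdvd
    refine (IsAlgClosed.splits m).eq_prod_roots.dvd.trans ?_
    exact ((isUnit_C.2 (leadingCoeff_ne_zero.2 hm).isUnit).mul_left_dvd).2 hdvd
  have hX : IsUnit (AdjoinRoot.mk m X) := by
    obtain ⟨a, b, hab⟩ := (irreducible_X.coprime_iff_not_dvd).2 (mt X_dvd_iff.1 hm0)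
    refine IsUnit.of_mul_eq_one (AdjoinRoot.mk m a) ?_
    rw [← map_mul, ← map_one (AdjoinRoot.mk m), ← hab, map_add, map_mul _ b m]
    simp [mul_comm]
  have hqu : IsUnit (AdjoinRoot.mk m q) := by
    rw [← isUnit_pow_iff hd0, ← map_pow, ← sub_add_cancel (q ^ d) X, map_add]
    exact hnil.isUnit_add_right_of_commute hX (Commute.all _ _)
  obtain ⟨y, ⟨-, hy⟩, -⟩ := existsUnique_nilpotent_sub_and_aeval_eq_zero
    (P := X ^ d - C (AdjoinRoot.mk m X)) (x := AdjoinRoot.mk m q)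
    (by simpa using hnil)
    (by
      -- The derivative of `Y ^ d - X` at `q` is `d * q ^ (d - 1)`.
      have hdu : IsUnit (d : AdjoinRoot m) := by
        rw [← map_natCast (algebraMap K (AdjoinRoot m))]
        exact hd.isUnit.map _
      simpa [derivative_X_pow] using hdu.mul (hqu.pow (d - 1)))
  obtain ⟨p, rfl⟩ := AdjoinRoot.mk_surjective y
  refine ⟨p, AdjoinRoot.mk_eq_zero.1 ?_⟩
  simpa using hy

theorem Matrix.exists_aeval_pow_eq {K ι : Type*} [Field K] [IsAlgClosed K] [Fintype ι]
    [DecidableEq ι] {d : ℕ} (hd : (d : K) ≠ 0) {B : Matrix ι ι K} (hB : IsUnit B) :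
    ∃ p : K[X], aeval B p ^ d = B := by
  have h0 : B.charpoly.coeff 0 ≠ 0 := fun h => by
    have := (Matrix.isUnit_iff_isUnit_det B).1 hB
    rw [Matrix.det_eq_sign_charpoly_coeff, h] at this
    simp at this
  obtain ⟨p, c, hp⟩ := exists_dvd_pow_sub_X hd h0
  refine ⟨p, ?_⟩
  have := congrArg (aeval B) hp
  rwa [map_mul, Matrix.aeval_self_charpoly, zero_mul, map_sub, map_pow, aeval_X, sub_eq_zero]
    at this

end RootExtraction

/-! ### Jacobian ideals and spans of partial derivatives -/

/-- An element of degree `e` of an ideal generated by forms of degree `e` is a combination of the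
generators with constant coefficients. -/
theorem MvPolynomial.mem_span_of_mem_ideal_span {k σ ι : Type*} [Field k] [Finite ι] {e : ℕ}
    {F : ι → MvPolynomial σ k} (hF : ∀ i, (F i).IsHomogeneous e) {p : MvPolynomial σ k}
    (hp : p.IsHomogeneous e) (h : p ∈ Ideal.span (Set.range F)) :
    p ∈ Submodule.span k (Set.range F) := by
  have := Fintype.ofFinite ι
  obtain ⟨c, rfl⟩ := Ideal.mem_span_range_iff_exists_fun.1 h
  rw [← homogeneousComponent_eq_self hp, map_sum]
  refine Submodule.sum_mem _ fun i _ => ?_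
  have hi : homogeneousComponent e (c i * F i) = coeff 0 (c i) • F i := by
    let _ := gradedAlgebra (σ := σ) (R := k)
    have := DirectSum.coe_decompose_mul_add_of_right_mem (homogeneousSubmodule σ k)
      (i := 0) (a := c i) (hF i)
    rw [zero_add] at this
    rw [smul_eq_C_mul, ← homogeneousComponent_zero, ← decomposition.decompose'_apply,
      ← decomposition.decompose'_apply]
    exact this
  rw [hi]
  exact Submodule.smul_mem _ _ (Submodule.subset_span ⟨i, rfl⟩)

theorem LinearMap.exists_linearEquiv_comp_eq_of_range_eq {K V W : Type*} [Field K]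
    [AddCommGroup V] [Module K V] [FiniteDimensional K V] [AddCommGroup W] [Module K W]
    {φ ψ : V →ₗ[K] W} (h : range φ = range ψ) : ∃ e : V ≃ₗ[K] V, ∀ v, φ (e v) = ψ v := by
  obtain ⟨C, hC⟩ := (ker φ).exists_isCompl
  obtain ⟨D, hD⟩ := (ker ψ).exists_isCompl
  have hker : Module.finrank K (ker ψ) = Module.finrank K (ker φ) := by
    have h1 := φ.finrank_range_add_finrank_ker
    have h2 := ψ.finrank_range_add_finrank_ker
    rw [h] at h1
    omega
  let eker : ker ψ ≃ₗ[K] ker φ := LinearEquiv.ofFinrankEq _ _ hker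
  let ecompl : D ≃ₗ[K] C := ψ.kerComplementEquivRange hD.symm ≪≫ₗ LinearEquiv.ofEq _ _ h.symm ≪≫ₗ
    (φ.kerComplementEquivRange hC.symm).symm
  have hecompl (x : D) : φ (ecompl x) = ψ x := by
    have := (φ.kerComplementEquivRange hC.symm).apply_symm_apply
      (LinearEquiv.ofEq _ _ h.symm (ψ.kerComplementEquivRange hD.symm x))
    exact congrArg Subtype.val this
  -- Match the kernels arbitrarily, and the complements through the common range.
  refine ⟨(Submodule.prodEquivOfIsCompl _ _ hD).symm ≪≫ₗ (eker.prodCongr ecompl) ≪≫ₗ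
    Submodule.prodEquivOfIsCompl _ _ hC, fun v => ?_⟩
  obtain ⟨⟨x, y⟩, rfl⟩ := (Submodule.prodEquivOfIsCompl _ _ hD).surjective v
  simp [hecompl]

/-- Two families of the same finite size with the same span differ by an invertible matrix, even
when they are linearly dependent. -/
theorem exists_isUnit_matrix_of_span_range_eq {K W ι : Type*} [Field K] [AddCommGroup W]
    [Module K W] [Fintype ι] [DecidableEq ι] {F G : ι → W}
    (h : Submodule.span K (Set.range F) = Submodule.span K (Set.range G)) :
    ∃ B : Matrix ι ι K, IsUnit B ∧ ∀ i, G i = ∑ j, B j i • F j := by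
  obtain ⟨e, he⟩ := LinearMap.exists_linearEquiv_comp_eq_of_range_eq
    (φ := Fintype.linearCombination K F) (ψ := Fintype.linearCombination K G)
    (by simpa [Fintype.range_linearCombination] using h)
  refine ⟨LinearMap.toMatrix' e.toLinearMap, ?_, fun i => ?_⟩
  · rw [LinearMap.isUnit_toMatrix'_iff]
    exact (LinearMap.GeneralLinearGroup.ofLinearEquiv e).isUnit
  · have := he (Pi.single i 1)
    rw [Fintype.linearCombination_apply_single, one_smul, Fintype.linearCombination_apply] at this
    simp [← this, LinearMap.toMatrix'_apply]

open MvPolynomial in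
theorem span_pderiv_eq_of_jacobianIdeal_eq {k : Type*} [Field k] {n d : ℕ}
    {f g : MvPolynomial (Fin n) k} (hf : f.IsHomogeneous d) (hg : g.IsHomogeneous d)
    (hJ : jacobianIdeal f = jacobianIdeal g) :
    Submodule.span k (Set.range fun i => pderiv i f) =
      Submodule.span k (Set.range fun i => pderiv i g) := by
  unfold jacobianIdeal at hJ
  apply le_antisymm <;> rw [Submodule.span_le] <;> rintro _ ⟨i, rfl⟩
  · exact mem_span_of_mem_ideal_span (fun j => hg.pderiv) hf.pderiv
      (hJ ▸ Ideal.subset_span ⟨i, rfl⟩)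
  · exact mem_span_of_mem_ideal_span (fun j => hf.pderiv) hg.pderiv
      (hJ ▸ Ideal.subset_span ⟨i, rfl⟩)

open MvPolynomial in
/-- If the gradient of `g` is a constant matrix times that of `f`, the symmetry of the Hessian of
`g` is the self-adjointness of that matrix. -/
theorem hessianSelfAdjoint_of_pderiv_eq {k : Type*} [Field k] {n : ℕ}
    {f g : MvPolynomial (Fin n) k} {B : Matrix (Fin n) (Fin n) k}
    (h : ∀ i, pderiv i g = ∑ j, B j i • pderiv j f) : HessianSelfAdjoint f B := by
  ext1 i l
  have hs := pderiv_pderiv_comm i l g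
  rw [h, h] at hs
  simpa [polyHessian, Matrix.mul_apply, smul_eq_C_mul, mul_comm, pderiv_pderiv_comm l] using hs

open MvPolynomial Matrix in
theorem theorem1p4 {k : Type*} [Field k] [IsAlgClosed k] (n d : ℕ) (hd : 2 < d)
    (hchar : ringChar k = 0 ∨ d < ringChar k)
    (f g : MvPolynomial (Fin n) k) (hf : f.IsHomogeneous d) (hg : g.IsHomogeneous d)
    (hJ : jacobianIdeal f = jacobianIdeal g) :
    ∃ P : GL (Fin n) k, g = compLinear f (P : Matrix (Fin n) (Fin n) k) := by
  have hd0 : 0 < d := by omega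
  have hcast (m : ℕ) (h0 : 0 < m) (hm : m ≤ d) : (m : k) ≠ 0 := by
    rw [Ne, ringChar.spec]
    intro hdvd
    rcases hchar with h | h
    · rw [h, zero_dvd_iff] at hdvd
      omega
    · have := Nat.le_of_dvd h0 hdvd
      omega
  obtain ⟨B, hB, hgrad⟩ :=
    exists_isUnit_matrix_of_span_range_eq (span_pderiv_eq_of_jacobianIdeal_eq hf hg hJ)
  obtain ⟨p, hp⟩ := Matrix.exists_aeval_pow_eq (hcast d hd0 le_rfl) hB
  have hP : IsUnit (Polynomial.aeval B p) := by
    rwa [← isUnit_pow_iff hd0.ne', hp]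
  refine ⟨hP.unit, ?_⟩
  have hdX : (d : MvPolynomial (Fin n) k) ≠ 0 := by
    rw [← map_natCast (C : k →+* MvPolynomial (Fin n) k)]
    exact (map_ne_zero_iff _ (C_injective _ _)).2 (hcast d hd0 le_rfl)
  have hpow : ((Polynomial.aeval B p).map (C : k →+* MvPolynomial (Fin n) k)) ^ d = B.map C := by
    rw [← RingHom.mapMatrix_apply, ← map_pow, hp, RingHom.mapMatrix_apply]
  have hgradvec : polyGradient g = (B.map C)ᵀ *ᵥ polyGradient f := by
    ext1 i
    simp [polyGradient, hgrad, Matrix.mulVec, dotProduct, smul_eq_C_mul]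
  apply mul_left_cancel₀ hdX
  rw [IsUnit.unit_spec,
    ((hessianSelfAdjoint_of_pderiv_eq hgrad).aeval p).natCast_mul_compLinear hcast hd0 hf,
    hpow, ← X_dotProduct_polyGradient hg, hgradvec, Matrix.dotProduct_mulVec,
    Matrix.vecMul_transpose]
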